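/- Let $H$ be a complex Hilbert space and let $\tau=(T_1,\dots,T_n)$ be an $n$-tuple of commuting bounded hermitian operators on $H$ with a cyclic vector $\xi$, i.e. the vectors $p(T_1,\dots,T_n)\xi$, $p$ a polynomial, are dense in $H$ (so that $H$ is separable). Let $\sigma(\tau)\subset\mathbb R^n$ be the joint spectrum of $\tau$, that is, the set of the points $(\chi(T_1),\dots,\chi(T_n))$, where $\chi$ runs over the characters of the unital $C^*$-algebra generated by $\tau$. Let $\Phi$ be a norming function, i.e. a norm on the finitely supported real sequences which is invariant under permutations of the entries and under replacing entries by their absolute values, with $\Phi(1,0,0,\dots)=1$; for an arbitrary real sequence put $\Phi(r_1,r_2,\dots)=\sup_N\Phi(r_1,\dots,r_N,0,0,\dots)\in[0,\infty]$. For a finite rank operator $X$ on $H$ put $|X|_\Phi=\Phi(s_1,s_2,\dots)$, where $s_1\ge s_2\ge\dots$ are the eigenvalues of $(X^*X)^{1/2}$ in decreasing order, repeated according to multiplicity. The quasicentral modulus $k_\Phi(\tau)$ is the least $C\in[0,\infty]$ for which there are finite rank operators $0\le A_1\le A_2\le\dots\le I$ with $A_m\to I$ strongly and $$\lim_{m\to\infty}\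 \max_{1\le j\le n}|[A_m,T_j]|_\Phi=C .$$ For a bounded set $E\subset\mathbb R^n$ and $\epsilon>0$ let $$U_{\Phi,\epsilon}(E)=\inf\Big\{\Phi(r_1,r_2,\dots)\ :\ E\subset\bigcup_{j\in\mathbb N}B(x_j;r_j),\ 0<r_j<\epsilon\Big\},\qquad U^*_\Phi(E)=\lim_{\epsilon\to0}U_{\Phi,\epsilon}(E)\in[0,\infty],$$ where $B(x;r)$ is the open Euclidean ball of centre $x$ and radius $r$. Then $$k_\Phi(\tau)\le 2\,U^*_\Phi(\sigma(\tau)).$$ -/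

import Mathlib

open Filter Topology
open scoped ENNReal

noncomputable section

/-- A (symmetric) norming function: a norm on the space of finitely supported real sequences which
is invariant under permutations and under taking absolute values of the entries, and is
normalized by `Φ(1, 0, 0, …) = 1`. -/
structure NormingFunction where
  toFun : (ℕ →₀ ℝ) → ℝ
  pos' : ∀ f, f ≠ 0 → 0 < toFun f
  smul' : ∀ (c : ℝ) f, toFun (c • f) = |c| * toFun f
  add_le' : ∀ f g, toFun (f + g) ≤ toFun f + toFun g
  perm' : ∀ (σ : Equiv.Perm ℕ) f, toFun (f.equivMapDomain σ) = toFun f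
  abs' : ∀ f, toFun (f.mapRange abs abs_zero) = toFun f
  single' : toFun (Finsupp.single 0 1) = 1

/-- The value `Φ(r₁, r₂, …) = sup_N Φ(r₁, …, r_N, 0, 0, …) ∈ [0, ∞]` of a norming function on an
arbitrary real sequence. -/
def NormingFunction.eval (Φ : NormingFunction) (r : ℕ → ℝ) : ℝ≥0∞ :=
  ⨆ N : ℕ, ENNReal.ofReal (Φ.toFun (Finsupp.indicator (Finset.range N) fun i _ => r i))

section Operators

variable {H : Type*} [NormedAddCommGroup H] [InnerProductSpace ℂ H] [CompleteSpace H]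

/-- The `j`-th entry, `j = 0, 1, 2, …`, of the decreasing list of the eigenvalues of
`|X| = (X* X)^{1/2}`, repeated according to multiplicity (for `X` compact): the largest `μ ≥ 0`
such that the eigenspaces of `|X|` for the eigenvalues `ν ≥ μ` together span a space of dimension
at least `j + 1` (and `0` if there is no such `μ`). -/
def singularValue (X : H →L[ℂ] H) (j : ℕ) : ℝ :=
  sSup {μ : ℝ | 0 ≤ μ ∧ ((j + 1 : ℕ) : Cardinal) ≤
    Module.rank ℂ (⨆ ν : Set.Ici μ,
      Module.End.eigenspace ((CFC.abs X : H →L[ℂ] H) : H →ₗ[ℂ] H) ((ν : ℝ) : ℂ) : Submodule ℂ H)}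

/-- The norm `|X|_Φ = Φ(s₁(X), s₂(X), …) ∈ [0, ∞]` defined by a norming function. -/
def NormingFunction.opNorm (Φ : NormingFunction) (X : H →L[ℂ] H) : ℝ≥0∞ :=
  Φ.eval (singularValue X)

/-- `A₀ ≤ A₁ ≤ …` are finite rank operators with `0 ≤ A_m ≤ I` and `A_m ↑ I` (strongly). -/
structure IsFiniteRankApproxUnit (A : ℕ → H →L[ℂ] H) : Prop where
  finiteRank : ∀ m, FiniteDimensional ℂ (LinearMap.range (A m : H →ₗ[ℂ] H))
  nonneg : ∀ m, 0 ≤ A m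
  le_one : ∀ m, A m ≤ 1
  mono : Monotone A
  tendsto : ∀ x, Tendsto (fun m => A m x) atTop (𝓝 x)

/-- The quasicentral modulus `k_Φ(τ)`: the least `C ∈ [0, ∞]` for which there are finite rank
operators `0 ≤ A_m ≤ I`, `A_m ↑ I`, with `max_j |[A_m, T_j]|_Φ → C`. -/
def quasicentralModulus (Φ : NormingFunction) {n : ℕ} (T : Fin n → H →L[ℂ] H) : ℝ≥0∞ :=
  sInf {C : ℝ≥0∞ | ∃ A : ℕ → H →L[ℂ] H, IsFiniteRankApproxUnit A ∧
    Tendsto (fun m => ⨆ j, Φ.opNorm (A m * T j - T j * A m)) atTop (𝓝 C)}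

/-- The unital C*-algebra generated by `T₁, …, T_n`. -/
def generatedCStarAlgebra {n : ℕ} (T : Fin n → H →L[ℂ] H) : StarSubalgebra ℂ (H →L[ℂ] H) :=
  (StarAlgebra.adjoin ℂ (Set.range T)).topologicalClosure

theorem mem_generatedCStarAlgebra {n : ℕ} (T : Fin n → H →L[ℂ] H) (j : Fin n) :
    T j ∈ generatedCStarAlgebra T :=
  StarSubalgebra.le_topologicalClosure _ (StarAlgebra.subset_adjoin ℂ _ (Set.mem_range_self j))

/-- The joint spectrum `σ(τ) ⊆ ℝⁿ` of a tuple of commuting hermitian operators: the points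
`(χ(T₁), …, χ(T_n))`, where `χ` runs over the characters (the unital multiplicative linear
functionals) of the unital C*-algebra generated by `T₁, …, T_n`. -/
def jointSpectrum {n : ℕ} (T : Fin n → H →L[ℂ] H) : Set (EuclideanSpace ℝ (Fin n)) :=
  {x | ∃ χ : generatedCStarAlgebra T →ₐ[ℂ] ℂ,
    ∀ j, χ ⟨T j, mem_generatedCStarAlgebra T j⟩ = ((x j : ℝ) : ℂ)}

/-- `ξ` is a cyclic vector for `τ`: the vectors `p(T₁, …, T_n) ξ`, with `p` a polynomial,
are dense. -/
def IsCyclicVector {n : ℕ} (T : Fin n → H →L[ℂ] H) (ξ : H) : Prop :=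
  Dense {x : H | ∃ a ∈ Algebra.adjoin ℂ (Set.range T), a ξ = x}

end Operators

/-- `U_{Φ,ε}(E)`: the infimum of `Φ(r₁, r₂, …)` over the coverings of `E` by balls `B(x_j; r_j)`
of radius `r_j < ε`. -/
def coveringContent (Φ : NormingFunction) {n : ℕ} (ε : ℝ) (E : Set (EuclideanSpace ℝ (Fin n))) :
    ℝ≥0∞ :=
  sInf {c : ℝ≥0∞ | ∃ (x : ℕ → EuclideanSpace ℝ (Fin n)) (r : ℕ → ℝ),
    (∀ j, 0 < r j ∧ r j < ε) ∧ E ⊆ ⋃ j, Metric.ball (x j) (r j) ∧ c = Φ.eval r}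

/-- `U*_Φ(E)`, the limit of `U_{Φ,ε}(E)` as `ε → 0`, which by monotonicity in `ε` is a supremum
(see `tendsto_coveringContent`). -/
def hausdorffContent (Φ : NormingFunction) {n : ℕ} (E : Set (EuclideanSpace ℝ (Fin n))) : ℝ≥0∞ :=
  ⨆ (ε : ℝ) (_ : 0 < ε), coveringContent Φ ε E

theorem tendsto_coveringContent (Φ : NormingFunction) {n : ℕ}
    (E : Set (EuclideanSpace ℝ (Fin n))) :
    Tendsto (fun ε => coveringContent Φ ε E) (𝓝[>] 0) (𝓝 (hausdorffContent Φ E)) := by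
  have hanti : Antitone fun ε : ℝ => coveringContent Φ ε E := by
    intro a b hab
    refine sInf_le_sInf ?_
    rintro c ⟨x, r, hr, hE, hc⟩
    exact ⟨x, r, fun j => ⟨(hr j).1, (hr j).2.trans_le hab⟩, hE, hc⟩
  have h := hanti.tendsto_nhdsGT 0
  rwa [sSup_image] at h

end

/-! Cover the compact set `jointSpectrum T` by finitely many small balls `B(x_k; r_k)`, `k < N`,
with decreasing radii. Disjoint spectral projections `e_k` with sum `1` put the `T i` within `r_k`
of the scalars `x_k i` on the range of `e_k`. Let `P` project onto the span of the vectors `e_k ξ`.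
It fixes `ξ` and commutes with every `e_k`, so `[P, T i]` is block diagonal. Its `k`-th block equals
that of `[P, T i - x_k i]`, has norm at most `r_k`, and has rank at most `2` because `P` has rank at
most one there. Hence the singular values are dominated by `r₀, r₀, r₁, r₁, …`, and `|[P, T i]|_Φ ≤
2 Φ(r)` (`exists_projection_of_cover`, `eval_le_of_doubled`).

As the radii tend to `0` the commutators tend to `0` in norm; since `P` fixes the cyclic vector, `P
→ 1` strongly (`IsCyclicVector.tendsto_apply`).

These projections need not increase. Given a finite rank `0 ≤ A ≤ 1` with range projection `Q`, the
operator `Q + (1 - Q) P (1 - Q)` dominates `A` and differs from `P` by an operator of bounded rank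
and small norm, which costs arbitrarily little in `Φ`-norm (`exists_le_opNorm_commutator_le`).
Iteration gives the approximate unit. -/

namespace NormingFunction

/-! ### Norming functions: monotonicity and rearrangement. -/

variable (Φ : NormingFunction)

theorem toFun_zero : Φ.toFun 0 = 0 := by simpa using Φ.smul' 0 0

theorem toFun_nonneg (f : ℕ →₀ ℝ) : 0 ≤ Φ.toFun f := by
  rcases eq_or_ne f 0 with rfl | h
  · exact Φ.toFun_zero.ge
  · exact (Φ.pos' f h).le

/-- The support and its image are finite, so their complements in `ℕ` are equinumerous and the
partial injection extends to a permutation. -/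
theorem toFun_mapDomain {ι : ℕ → ℕ} {f : ℕ →₀ ℝ} (hι : Set.InjOn ι f.support) :
    Φ.toFun (f.mapDomain ι) = Φ.toFun f := by
  let s : Set ℕ := f.support
  let e : s ↪ ℕ := ⟨fun x => ι x, fun x y h => Subtype.ext (hι x.2 y.2 h)⟩
  have hs : s.Finite := f.support.finite_toSet
  have hr : (Set.range e).Finite := by
    have := hs.to_subtype
    exact Set.finite_range e
  have : Infinite (sᶜ : Set ℕ) := hs.infinite_compl.to_subtype
  have : Infinite ((Set.range e)ᶜ : Set ℕ) := hr.infinite_compl.to_subtype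
  obtain ⟨σ, hσ⟩ := Cardinal.extend_function e
    ⟨(nonempty_denumerable (sᶜ : Set ℕ)).some.eqv.trans
      (nonempty_denumerable ((Set.range e)ᶜ : Set ℕ)).some.eqv.symm⟩
  have h : f.mapDomain ι = f.equivMapDomain σ := by
    rw [Finsupp.equivMapDomain_eq_mapDomain]
    exact Finsupp.mapDomain_congr fun x hx => (hσ ⟨x, hx⟩).symm
  rw [h, Φ.perm']

theorem toFun_single (j : ℕ) (c : ℝ) : Φ.toFun (Finsupp.single j c) = |c| := by
  have h1 : Φ.toFun (Finsupp.single j 1) = 1 := by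
    have := Φ.toFun_mapDomain (f := Finsupp.single 0 1) (Equiv.swap 0 j).injective.injOn
    rwa [Finsupp.mapDomain_single, Equiv.swap_apply_left, Φ.single'] at this
  have : Finsupp.single j c = c • Finsupp.single j (1 : ℝ) := by simp
  rw [this, Φ.smul', h1, mul_one]

theorem toFun_congr_abs {f g : ℕ →₀ ℝ} (h : ∀ i, |f i| = |g i|) : Φ.toFun f = Φ.toFun g := by
  rw [← Φ.abs' f, ← Φ.abs' g]
  congr 1
  ext i
  simpa using h i

/-- With `f a = t * b` and `|t| ≤ 1`, `f` is a convex combination of its updates by `b` and by `-b`,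
which have equal norm. -/
theorem toFun_le_update {f : ℕ →₀ ℝ} {a : ℕ} {b : ℝ} (h : |f a| ≤ |b|) :
    Φ.toFun f ≤ Φ.toFun (f.update a b) := by
  classical
  rcases eq_or_ne b 0 with rfl | hb
  · have : f a = 0 := by simpa using h
    rw [← this, Finsupp.update_self]
  set t := f a / b with ht
  have ht1 : |t| ≤ 1 := by
    rw [ht, abs_div]
    exact div_le_one_of_le₀ h (abs_nonneg b)
  have ht2 := abs_le.mp ht1
  have hf : f = ((1 + t) / 2) • f.update a b + ((1 - t) / 2) • f.update a (-b) := by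
    ext i
    rcases eq_or_ne i a with rfl | hi
    · simp only [Finsupp.add_apply, Finsupp.smul_apply, Finsupp.coe_update, Function.update_self,
        smul_eq_mul, ht]
      field_simp
      ring
    · simp only [Finsupp.add_apply, Finsupp.smul_apply, Finsupp.coe_update,
        Function.update_of_ne hi, smul_eq_mul]
      ring
  have hflip : Φ.toFun (f.update a (-b)) = Φ.toFun (f.update a b) := by
    refine Φ.toFun_congr_abs fun i => ?_
    rcases eq_or_ne i a with rfl | hi
    · simp
    · simp [Function.update_of_ne hi]
  calc Φ.toFun f = _ := congrArg _ hf
    _ ≤ _ := Φ.add_le' _ _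
    _ = Φ.toFun (f.update a b) := by
      rw [Φ.smul', Φ.smul', hflip, abs_of_nonneg (by linarith), abs_of_nonneg (by linarith)]
      ring

theorem toFun_mono {f g : ℕ →₀ ℝ} (h : ∀ i, |f i| ≤ |g i|) : Φ.toFun f ≤ Φ.toFun g := by
  classical
  -- Entries are raised one at a time; `s` contains the places where `f` and `g` may still differ.
  suffices H : ∀ (s : Finset ℕ) (f : ℕ →₀ ℝ), (∀ i, |f i| ≤ |g i|) → (∀ i ∉ s, f i = g i) →
      Φ.toFun f ≤ Φ.toFun g by
    refine H (f.support ∪ g.support) f h fun i hi => ?_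
    simp only [Finset.mem_union, Finsupp.mem_support_iff, not_or, not_not] at hi
    rw [hi.1, hi.2]
  intro s
  induction s using Finset.induction_on with
  | empty =>
    intro f _ h
    rw [Finsupp.ext fun i => h i (Finset.notMem_empty i)]
  | insert a s _ ih =>
    intro f h1 h2
    refine (Φ.toFun_le_update (h1 a)).trans (ih _ (fun i => ?_) fun i hi => ?_)
    · rcases eq_or_ne i a with rfl | hi
      · simp
      · simpa [Function.update_of_ne hi] using h1 i
    · rcases eq_or_ne i a with rfl | hia
      · simp
      · simpa [Function.update_of_ne hia] using h2 i (by simp [hia, hi])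

theorem toFun_sum_le {ι : Type*} (s : Finset ι) (f : ι → ℕ →₀ ℝ) :
    Φ.toFun (∑ i ∈ s, f i) ≤ ∑ i ∈ s, Φ.toFun (f i) :=
  Finset.le_sum_of_subadditive _ Φ.toFun_zero.le Φ.add_le' s f

/-- A sequence whose first `R` terms are at most `B`, and whose remaining terms are dominated by
`r₀, r₀, r₁, r₁, …`, has norm at most `R * B + 2 * Φ(r)`. -/
theorem eval_le_of_doubled {s : ℕ → ℝ} (hs : ∀ j, 0 ≤ s j) {r : ℕ →₀ ℝ} {R : ℕ} {B : ℝ}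
    (hB : ∀ j < R, s j ≤ B) (h0 : ∀ k, s (2 * k + R) ≤ r k) (h1 : ∀ k, s (2 * k + 1 + R) ≤ r k) :
    Φ.eval s ≤ ENNReal.ofReal (R * B + 2 * Φ.toFun r) := by
  classical
  refine iSup_le fun N => ENNReal.ofReal_le_ofReal ?_
  let ι₀ : ℕ → ℕ := fun k => 2 * k + R
  let ι₁ : ℕ → ℕ := fun k => 2 * k + 1 + R
  have hι₀ : Function.Injective ι₀ := fun a b h => by simp only [ι₀] at h; omega
  have hι₁ : Function.Injective ι₁ := fun a b h => by simp only [ι₁] at h; omega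
  have hr : ∀ k, 0 ≤ r k := fun k => (hs _).trans (h0 k)
  let w₁ : ℕ →₀ ℝ := ∑ j ∈ Finset.range R, Finsupp.single j (s j)
  -- The head plus two copies of `r`, spread over the even and the odd offsets from `R`. Each copy
  -- has norm `Φ(r)`: this is the factor `2` of the theorem.
  let w : ℕ →₀ ℝ := w₁ + (r.mapDomain ι₀ + r.mapDomain ι₁)
  have hpos : ∀ (ι : ℕ → ℕ), Function.Injective ι → ∀ i, 0 ≤ r.mapDomain ι i := by
    intro ι hι i
    by_cases hi : i ∈ Set.range ι
    · obtain ⟨k, rfl⟩ := hi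
      rw [Finsupp.mapDomain_apply hι]
      exact hr k
    · rw [Finsupp.mapDomain_of_notMem_range _ _ hi]
  have hw₁ : ∀ i, w₁ i = if i < R then s i else 0 := by
    intro i
    simp [w₁, Finsupp.finsetSum_apply, Finsupp.single_apply]
  have hle : ∀ i, s i ≤ w i := by
    intro i
    have p0 := hpos ι₀ hι₀ i
    have p1 := hpos ι₁ hι₁ i
    simp only [w, Finsupp.add_apply, hw₁]
    split_ifs with hi
    · linarith
    · obtain ⟨k, hk | hk⟩ : ∃ k, i = ι₀ k ∨ i = ι₁ k :=
        ⟨(i - R) / 2, by simp only [ι₀, ι₁]; omega⟩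
      · have := h0 k
        rw [hk, Finsupp.mapDomain_apply hι₀]
        rw [hk] at p1
        linarith
      · have := h1 k
        rw [hk, Finsupp.mapDomain_apply hι₁]
        rw [hk] at p0
        linarith
  calc Φ.toFun (Finsupp.indicator (Finset.range N) fun i _ => s i) ≤ Φ.toFun w := by
        refine Φ.toFun_mono fun i => ?_
        rw [abs_of_nonneg ((hs i).trans (hle i)), Finsupp.indicator_apply]
        split_ifs
        · rw [abs_of_nonneg (hs i)]
          exact hle i
        · rw [abs_zero]
          exact (hs i).trans (hle i)
    _ ≤ Φ.toFun w₁ + (Φ.toFun (r.mapDomain ι₀) + Φ.toFun (r.mapDomain ι₁)) :=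
        (Φ.add_le' _ _).trans (add_le_add le_rfl (Φ.add_le' _ _))
    _ ≤ R * B + 2 * Φ.toFun r := by
        have : Φ.toFun w₁ ≤ R * B := by
          refine (Φ.toFun_sum_le _ _).trans ?_
          refine (Finset.sum_le_card_nsmul _ _ B fun j hj => ?_).trans (by simp)
          rw [Φ.toFun_single, abs_of_nonneg (hs j)]
          exact hB j (Finset.mem_range.mp hj)
        rw [Φ.toFun_mapDomain hι₀.injOn, Φ.toFun_mapDomain hι₁.injOn]
        linarith

end NormingFunction

/-! ### Singular values and approximation numbers. -/

section SingularValues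

variable {H : Type*} [NormedAddCommGroup H] [InnerProductSpace ℂ H]

theorem norm_cfcAbs_apply [CompleteSpace H] (X : H →L[ℂ] H) (v : H) : ‖CFC.abs X v‖ = ‖X v‖ := by
  have h : star (CFC.abs X) * CFC.abs X = star X * X := by
    rw [(CFC.abs_nonneg X).isSelfAdjoint.star_eq, CFC.abs_mul_abs]
  have key : ∀ Y : H →L[ℂ] H, inner ℂ ((star Y * Y) v) v = ((‖Y v‖ ^ 2 : ℝ) : ℂ) := by
    intro Y
    rw [mul_apply_eq_comp, ContinuousLinearMap.star_eq_adjoint,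
      ContinuousLinearMap.adjoint_inner_left, inner_self_eq_norm_sq_to_K]
    norm_cast
  have h2 := (key (CFC.abs X)).symm.trans ((congrArg (fun Z => inner ℂ (Z v) v) h).trans (key X))
  have h3 : ‖CFC.abs X v‖ ^ 2 = ‖X v‖ ^ 2 := by exact_mod_cast h2
  exact (sq_eq_sq₀ (norm_nonneg _) (norm_nonneg _)).mp h3

/-- A symmetric operator is bounded below by `μ ≥ 0` on the span of its eigenspaces for eigenvalues
`ν ≥ μ`. -/
theorem LinearMap.IsSymmetric.le_norm_of_mem_iSup_eigenspace {A : H →ₗ[ℂ] H} (hA : A.IsSymmetric)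
    {μ : ℝ} (hμ : 0 ≤ μ) {v : H}
    (hv : v ∈ (⨆ ν : Set.Ici μ, Module.End.eigenspace A ((ν : ℝ) : ℂ) : Submodule ℂ H)) :
    μ * ‖v‖ ≤ ‖A v‖ := by
  obtain ⟨f, hf, rfl⟩ := (Submodule.mem_iSup_iff_exists_finsupp _ _).mp hv
  have hO : OrthogonalFamily ℂ (fun ν : Set.Ici μ => Module.End.eigenspace A ((ν : ℝ) : ℂ))
      fun ν => (Module.End.eigenspace A ((ν : ℝ) : ℂ)).subtypeₗᵢ :=
    hA.orthogonalFamily_eigenspaces.comp (γ := Set.Ici μ) (f := fun ν => ((ν : ℝ) : ℂ))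
      fun a b h => Subtype.ext (Complex.ofReal_injective h)
  let l : ∀ ν : Set.Ici μ, Module.End.eigenspace A ((ν : ℝ) : ℂ) := fun ν => ⟨f ν, hf ν⟩
  have hAf : ∀ ν, A (f ν) = ((ν : ℝ) : ℂ) • f ν := fun ν =>
    Module.End.mem_eigenspace_iff.mp (hf ν)
  have e1 := hO.norm_sum l f.support
  have e2 := hO.norm_sum (fun ν => ((ν : ℝ) : ℂ) • l ν) f.support
  simp only [Submodule.coe_subtypeₗᵢ, Submodule.subtype_apply, Submodule.coe_smul, l] at e1 e2
  have e3 : A (f.sum fun _ x => x) = ∑ ν ∈ f.support, ((ν : ℝ) : ℂ) • f ν := by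
    rw [Finsupp.sum, map_sum]
    exact Finset.sum_congr rfl fun ν _ => hAf ν
  refine le_of_sq_le_sq ?_ (norm_nonneg _)
  rw [e3, e2, mul_pow, Finsupp.sum, e1, Finset.mul_sum]
  refine Finset.sum_le_sum fun ν _ => ?_
  have hν : μ ≤ (ν : ℝ) := ν.2
  have : ‖(⟨f ν, hf ν⟩ : Module.End.eigenspace A ((ν : ℝ) : ℂ))‖ = ‖f ν‖ := rfl
  rw [norm_smul, mul_pow, Complex.norm_real, Real.norm_of_nonneg (hμ.trans hν), this]
  gcongr

theorem singularValue_nonneg [CompleteSpace H] (X : H →L[ℂ] H) (j : ℕ) : 0 ≤ singularValue X j :=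
  Real.sSup_nonneg fun _ h => h.1

/-- Singular values are dominated by approximation numbers. -/
theorem singularValue_le_norm_sub [CompleteSpace H] (X L : H →L[ℂ] H) {j : ℕ}
    (hL : LinearMap.rank (L : H →ₗ[ℂ] H) ≤ j) : singularValue X j ≤ ‖X - L‖ := by
  refine Real.sSup_le ?_ (norm_nonneg _)
  rintro μ ⟨hμ, hrank⟩
  have hsym : ((CFC.abs X : H →L[ℂ] H) : H →ₗ[ℂ] H).IsSymmetric :=
    ContinuousLinearMap.isSelfAdjoint_iff_isSymmetric.mp (CFC.abs_nonneg X).isSelfAdjoint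
  set E : Submodule ℂ H := ⨆ ν : Set.Ici μ,
      Module.End.eigenspace ((CFC.abs X : H →L[ℂ] H) : H →ₗ[ℂ] H) ((ν : ℝ) : ℂ) with hE
  -- `E` has dimension at least `j + 1`, more than the rank of `L`, so `L` is not injective on `E`.
  obtain ⟨v, hvE, hv0, hLv⟩ : ∃ v ∈ E, v ≠ 0 ∧ L v = 0 := by
    by_contra! hcon
    let g : E →ₗ[ℂ] LinearMap.range (L : H →ₗ[ℂ] H) :=
      (LinearMap.rangeRestrict (L : H →ₗ[ℂ] H)).comp E.subtype
    have hg : Function.Injective g := by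
      rw [← LinearMap.ker_eq_bot, LinearMap.ker_eq_bot']
      intro v hv
      by_contra hne
      exact hcon v v.2 (fun h => hne (Subtype.ext h)) (congrArg Subtype.val hv)
    have h1 := LinearMap.rank_le_of_injective g hg
    have h2 : ((j + 1 : ℕ) : Cardinal) ≤ (j : ℕ) := (hrank.trans h1).trans hL
    have h3 := Nat.cast_le.mp h2
    omega
  have h1 := hsym.le_norm_of_mem_iSup_eigenspace hμ hvE
  have h2 : ‖CFC.abs X v‖ = ‖(X - L) v‖ := by
    rw [norm_cfcAbs_apply, sub_apply, hLv, sub_zero]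
  have h3 : μ * ‖v‖ ≤ ‖X - L‖ * ‖v‖ := h1.trans (h2.le.trans ((X - L).le_opNorm v))
  exact le_of_mul_le_mul_right h3 (norm_pos_iff.mpr hv0)

end SingularValues

/-! ### Positive parts, characters and kernel projections. -/

section Spectral

/-- A self-adjoint element is a difference of squares of self-adjoint elements with product `0`. -/
theorem IsSelfAdjoint.exists_sub_squares {A : Type*} [CStarAlgebra A] {a : A}
    (ha : IsSelfAdjoint a) :
    ∃ g d : A, IsSelfAdjoint g ∧ IsSelfAdjoint d ∧ g * d = 0 ∧ g * g - d * d = a := by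
  have hg : Continuous fun t : ℝ => √t := Real.continuous_sqrt
  have hd : Continuous fun t : ℝ => √(-t) := Real.continuous_sqrt.comp continuous_neg
  -- Since `√` vanishes on negative reals, these are the square roots of the positive and negative
  -- parts.
  refine ⟨cfc (fun t : ℝ => √t) a, cfc (fun t : ℝ => √(-t)) a, cfc_predicate _ a,
    cfc_predicate _ a, ?_, ?_⟩
  · rw [← cfc_mul _ _ a hg.continuousOn hd.continuousOn, ← cfc_const_zero ℝ a]
    refine cfc_congr fun t _ => ?_
    rcases le_total t 0 with h | h
    · simp [Real.sqrt_eq_zero_of_nonpos h]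
    · simp [Real.sqrt_eq_zero_of_nonpos (neg_nonpos.mpr h)]
  · rw [← cfc_mul _ _ a hg.continuousOn hg.continuousOn,
      ← cfc_mul _ _ a hd.continuousOn hd.continuousOn,
      ← cfc_sub (fun t : ℝ => √t * √t) (fun t : ℝ => √(-t) * √(-t)) a (hg.mul hg).continuousOn
        (hd.mul hd).continuousOn]
    conv_rhs => rw [← cfc_id ℝ a]
    refine cfc_congr fun t _ => ?_
    rcases le_total t 0 with h | h
    · simp [Real.sqrt_eq_zero_of_nonpos h, Real.mul_self_sqrt (neg_nonneg.mpr h)]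
    · simp [Real.sqrt_eq_zero_of_nonpos (neg_nonpos.mpr h), Real.mul_self_sqrt h]

theorem IsSelfAdjoint.exists_ofReal_eq_character {A : Type*} [CommCStarAlgebra A] {a : A}
    (ha : IsSelfAdjoint a) (χ : WeakDual.characterSpace ℂ A) : ((χ a).re : ℂ) = χ a := by
  have : star (χ a) = χ a := by rw [← map_star, ha.star_eq]
  exact Complex.conj_eq_iff_re.mp this

/-- If self-adjoint elements `a₀, …, a_{N-1}` of a commutative C⋆-algebra are such that every
character is negative at one of them, then they can be written as `g_l² - d_l²` with
`g₀ ⋯ g_{N-1} = 0`. -/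
theorem exists_sub_squares_of_forall_character {A : Type*} [CommCStarAlgebra A] {N : ℕ}
    {a : ℕ → A} (ha : ∀ l, IsSelfAdjoint (a l))
    (hχ : ∀ χ : WeakDual.characterSpace ℂ A, ∃ l < N, (χ (a l)).re < 0) :
    ∃ g d : ℕ → A, (∀ l, IsSelfAdjoint (g l)) ∧ (∀ l, IsSelfAdjoint (d l)) ∧
      (∀ l, g l * g l - d l * d l = a l) ∧ ∏ l ∈ Finset.Ico 0 N, g l = 0 := by
  choose g d hg hd hgd hga using fun l => (ha l).exists_sub_squares
  refine ⟨g, d, hg, hd, hga, (gelfandTransform_isometry A).injective ?_⟩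
  rw [map_zero]
  ext χ
  obtain ⟨l, hl, hneg⟩ := hχ χ
  -- Where `a l` is negative its positive part vanishes; every character thus kills some factor of
  -- the product.
  have h0 : χ (g l) = 0 := by
    have h1 := (hg l).exists_ofReal_eq_character χ
    have h2 := (hd l).exists_ofReal_eq_character χ
    have h3 : χ (g l) * χ (d l) = 0 := by rw [← map_mul, hgd, map_zero]
    rcases mul_eq_zero.mp h3 with h | h
    · exact h
    · rw [← hga l, map_sub, map_mul, map_mul, h, mul_zero, sub_zero, ← h1] at hneg
      norm_cast at hneg
      exact absurd hneg (not_lt.mpr (mul_self_nonneg _))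
  change χ (∏ l ∈ Finset.Ico 0 N, g l) = 0
  rw [map_prod]
  exact Finset.prod_eq_zero (Finset.mem_Ico.mpr ⟨Nat.zero_le l, hl⟩) h0

variable {H : Type*} [NormedAddCommGroup H] [InnerProductSpace ℂ H] [CompleteSpace H]

/-- Invariance under `C` gives `P C P = C P`; invariance under `star C` gives, after taking
adjoints, `P C P = P C`. -/
theorem commute_starProjection_of_invariant {K : Submodule ℂ H} [K.HasOrthogonalProjection]
    {C : H →L[ℂ] H} (h : ∀ v ∈ K, C v ∈ K) (h' : ∀ v ∈ K, star C v ∈ K) :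
    Commute C K.starProjection := by
  have key : ∀ D : H →L[ℂ] H, (∀ v ∈ K, D v ∈ K) →
      K.starProjection * D * K.starProjection = D * K.starProjection := by
    intro D hD
    ext v
    exact Submodule.starProjection_eq_self_iff.mpr (hD _ (K.starProjection_apply_mem v))
  have hp : star K.starProjection = K.starProjection :=
    (isStarProjection_starProjection (U := K)).isSelfAdjoint.star_eq
  have h1 := key C h
  have h2 := congrArg star (key _ h')
  simp only [star_mul, star_star, hp, ← mul_assoc] at h2
  exact h1.symm.trans h2

/-- The projection onto the kernel of a self-adjoint operator. -/
theorem IsSelfAdjoint.exists_kernel_projection {g : H →L[ℂ] H} (hg : IsSelfAdjoint g) :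
    ∃ p : H →L[ℂ] H, IsStarProjection p ∧ g * p = 0 ∧ (∀ C, C * g = 0 → C * (1 - p) = 0) ∧
      ∀ C, IsSelfAdjoint C → Commute C g → Commute C p := by
  let K : Submodule ℂ H := LinearMap.ker (g : H →ₗ[ℂ] H)
  have hK : CompleteSpace K := g.isClosed_ker.completeSpace_coe
  have hmem : ∀ v, v ∈ K ↔ g v = 0 := fun v => LinearMap.mem_ker
  have hp : IsStarProjection K.starProjection := isStarProjection_starProjection
  refine ⟨K.starProjection, hp, ?_, fun C hC => ?_, fun C hC hCg => ?_⟩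
  · ext v
    exact (hmem _).mp (K.starProjection_apply_mem v)
  -- By adjunction the range of `star C` lies in the kernel of `g`, so the projection fixes it.
  · have h1 : g * star C = 0 := by rw [← hg.star_eq, ← star_mul, hC, star_zero]
    have h2 : K.starProjection * star C = star C := by
      ext v
      exact Submodule.starProjection_eq_self_iff.mpr ((hmem _).mpr congr($h1 v))
    have h3 := congrArg star h2
    rw [star_mul, star_star, hp.isSelfAdjoint.star_eq] at h3
    rw [mul_sub, mul_one, h3, sub_self]
  · have hinv : ∀ v ∈ K, C v ∈ K := by
      intro v hv
      have h1 : C (g v) = g (C v) := congr($(hCg.eq) v)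
      rw [hmem, ← h1, (hmem v).mp hv, map_zero]
    exact commute_starProjection_of_invariant hinv (by rwa [hC.star_eq])

end Spectral

/-! ### Compactness of the joint spectrum and the spectral flag. -/

section Flag

variable {H : Type*} [NormedAddCommGroup H] [InnerProductSpace ℂ H] [CompleteSpace H]

theorem isClosed_generatedCStarAlgebra {n : ℕ} (T : Fin n → H →L[ℂ] H) :
    IsClosed (generatedCStarAlgebra T : Set (H →L[ℂ] H)) :=
  StarSubalgebra.isClosed_topologicalClosure _

theorem generatedCStarAlgebra_mul_comm {n : ℕ} {T : Fin n → H →L[ℂ] H}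
    (hT : ∀ j, IsSelfAdjoint (T j)) (hcomm : ∀ i j, Commute (T i) (T j))
    (a b : generatedCStarAlgebra T) : a * b = b * a := by
  have := StarAlgebra.isMulCommutative_adjoin ℂ (s := Set.range T)
    (by rintro _ ⟨i, rfl⟩ _ ⟨j, rfl⟩; exact hcomm i j)
    (by rintro _ ⟨i, rfl⟩ _ ⟨j, rfl⟩; rw [(hT j).star_eq]; exact hcomm i j)
  exact (StarSubalgebra.commRingTopologicalClosure (StarAlgebra.adjoin ℂ (Set.range T))
    mul_comm').mul_comm a b

/-- The C⋆-algebra generated by commuting self-adjoint operators is commutative. -/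
noncomputable abbrev generatedCommCStarAlgebra {n : ℕ} {T : Fin n → H →L[ℂ] H}
    (hT : ∀ j, IsSelfAdjoint (T j)) (hcomm : ∀ i j, Commute (T i) (T j)) :
    CommCStarAlgebra (generatedCStarAlgebra T) :=
  { StarSubalgebra.cstarAlgebra (h_closed := isClosed_generatedCStarAlgebra T)
      (generatedCStarAlgebra T) with
    mul_comm := generatedCStarAlgebra_mul_comm hT hcomm }

theorem isCompact_jointSpectrum {n : ℕ} {T : Fin n → H →L[ℂ] H}
    (hT : ∀ j, IsSelfAdjoint (T j)) (hcomm : ∀ i j, Commute (T i) (T j)) :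
    IsCompact (jointSpectrum T) := by
  let := generatedCommCStarAlgebra hT hcomm
  let t : Fin n → generatedCStarAlgebra T := fun j => ⟨T j, mem_generatedCStarAlgebra T j⟩
  let F : WeakDual.characterSpace ℂ (generatedCStarAlgebra T) → EuclideanSpace ℝ (Fin n) :=
    fun χ => WithLp.toLp 2 fun j => (χ (t j)).re
  have hF : Continuous F := by
    refine (PiLp.continuous_toLp 2 _).comp (continuous_pi fun j => Complex.continuous_re.comp ?_)
    exact (WeakDual.eval_continuous (t j)).comp continuous_subtype_val
  have ht : ∀ j, IsSelfAdjoint (t j) := fun j => Subtype.ext (hT j)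
  have : jointSpectrum T = Set.range F := by
    ext y
    constructor
    · rintro ⟨χ, hχ⟩
      -- Algebraic characters are automatically continuous, so they are the points of the compact
      -- character space.
      refine ⟨WeakDual.CharacterSpace.equivAlgHom.symm χ, ?_⟩
      ext j
      exact (congrArg Complex.re (hχ j)).trans (Complex.ofReal_re _)
    · rintro ⟨χ, rfl⟩
      exact ⟨WeakDual.CharacterSpace.toAlgHom χ,
        fun j => ((ht j).exists_ofReal_eq_character χ).symm⟩
  rw [this]
  exact isCompact_range hF

/-- If finitely many balls cover the joint spectrum, then the operators
`|T - x_l|² - r_l²` are differences `g_l² - d_l²` with `g_{N-1} ⋯ g₀ = 0`. -/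
theorem exists_sub_squares_of_jointSpectrum_subset {n : ℕ} {T : Fin n → H →L[ℂ] H}
    (hT : ∀ j, IsSelfAdjoint (T j)) (hcomm : ∀ i j, Commute (T i) (T j)) {N : ℕ}
    {x : ℕ → EuclideanSpace ℝ (Fin n)} {r : ℕ → ℝ}
    (hcov : jointSpectrum T ⊆ ⋃ l ∈ Finset.range N, Metric.ball (x l) (r l)) :
    ∃ g d G : ℕ → H →L[ℂ] H, (∀ l, IsSelfAdjoint (g l)) ∧ (∀ l, IsSelfAdjoint (d l)) ∧
      (∀ l, g l * g l - d l * d l =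
        ∑ i, (T i - algebraMap ℂ (H →L[ℂ] H) (x l i : ℝ)) ^ 2
          - algebraMap ℂ (H →L[ℂ] H) ((r l ^ 2 : ℝ) : ℂ)) ∧
      (∀ l m, Commute (g l) (g m)) ∧ (∀ i l, Commute (T i) (g l)) ∧
      G 0 = 0 ∧ G N = 1 ∧ ∀ k < N, G k = G (k + 1) * g k := by
  let := generatedCommCStarAlgebra hT hcomm
  let t : Fin n → generatedCStarAlgebra T := fun j => ⟨T j, mem_generatedCStarAlgebra T j⟩
  have ht : ∀ j, IsSelfAdjoint (t j) := fun j => Subtype.ext (hT j)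
  let a : ℕ → generatedCStarAlgebra T := fun l =>
    ∑ i, (t i - algebraMap ℂ _ (x l i : ℝ)) ^ 2 - algebraMap ℂ _ ((r l ^ 2 : ℝ) : ℂ)
  have hsa : ∀ s : ℝ, IsSelfAdjoint (algebraMap ℂ (generatedCStarAlgebra T) (s : ℂ)) := fun s =>
    IsSelfAdjoint.algebraMap _ (Complex.conj_ofReal s)
  have ha : ∀ l, IsSelfAdjoint (a l) := fun l =>
    (isSelfAdjoint_sum _ fun i _ => ((ht i).sub (hsa _)).pow 2).sub (hsa _)
  obtain ⟨g, d, hg, hd, hgd, hprod⟩ := exists_sub_squares_of_forall_character (N := N) ha (by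
    intro χ
    have hre := fun j => (ht j).exists_ofReal_eq_character χ
    have hmem : (WithLp.toLp 2 fun j => (χ (t j)).re : EuclideanSpace ℝ (Fin n)) ∈
        jointSpectrum T :=
      ⟨WeakDual.CharacterSpace.toAlgHom χ, fun j => (hre j).symm⟩
    obtain ⟨l, hl, hball⟩ := Set.mem_iUnion₂.mp (hcov hmem)
    refine ⟨l, Finset.mem_range.mp hl, ?_⟩
    have hχ : χ (a l) = ((∑ i, ((χ (t i)).re - x l i) ^ 2 - r l ^ 2 : ℝ) : ℂ) := by
      simp only [a, map_sub, map_sum, map_pow, AlgHomClass.commutes]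
      push_cast
      congr 1
      exact Finset.sum_congr rfl fun i _ => by rw [hre i]; rfl
    rw [hχ, Complex.ofReal_re, sub_neg]
    rw [Metric.mem_ball, EuclideanSpace.dist_eq] at hball
    have h0 : 0 ≤ ∑ i, ((χ (t i)).re - x l i) ^ 2 := Finset.sum_nonneg fun i _ => sq_nonneg _
    have h1 := pow_lt_pow_left₀ hball (Real.sqrt_nonneg _) two_ne_zero
    simp only [Real.dist_eq, sq_abs] at h1
    rwa [Real.sq_sqrt h0] at h1)
  -- `G k` is the tail product of `g l` over `k ≤ l < N`: empty for `k = N`, the vanishing full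
  -- product for `k = 0`.
  refine ⟨fun l => g l, fun l => d l, fun k => ((∏ l ∈ Finset.Ico k N, g l :
    generatedCStarAlgebra T) : H →L[ℂ] H), fun l => congrArg Subtype.val (hg l),
    fun l => congrArg Subtype.val (hd l), fun l => ?_, fun l m => ?_, fun i l => ?_, ?_, ?_, ?_⟩
  · refine (congrArg Subtype.val (hgd l)).trans ?_
    change (generatedCStarAlgebra T).subtype (a l) = _
    simp only [a, map_sub, map_sum, map_pow, AlgHomClass.commutes]
    rfl
  · exact congrArg Subtype.val (mul_comm (g l) (g m))
  · exact congrArg Subtype.val (mul_comm (t i) (g l))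
  · simp only [hprod]
    rfl
  · simp only [Finset.Ico_self, Finset.prod_empty]
    rfl
  · intro k hk
    simp only [Finset.prod_eq_prod_Ico_succ_bot hk]
    exact congrArg Subtype.val (mul_comm (g k) _)

theorem IsSelfAdjoint.re_inner_mul_self {C : H →L[ℂ] H} (hC : IsSelfAdjoint C) (v : H) :
    RCLike.re (inner ℂ ((C * C) v) v) = ‖C v‖ ^ 2 := by
  rw [← inner_self_eq_norm_sq (𝕜 := ℂ), mul_apply_eq_comp,
    ← ContinuousLinearMap.adjoint_inner_left, ← ContinuousLinearMap.star_eq_adjoint, hC.star_eq]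

theorem IsStarProjection.mul_of_commute {p q : H →L[ℂ] H} (hp : IsStarProjection p)
    (hq : IsStarProjection q) (h : Commute p q) : IsStarProjection (p * q) :=
  ⟨hp.isIdempotentElem.mul_of_commute h hq.isIdempotentElem,
    (hp.isSelfAdjoint.commute_iff hq.isSelfAdjoint).mp h⟩

/-- A decreasing flag of spectral projections, from `1` to `0`, such that `T` is within `r_k` of
`x_k` on the range of the `k`-th difference. -/
theorem exists_spectral_flag {n : ℕ} {T : Fin n → H →L[ℂ] H}
    (hT : ∀ j, IsSelfAdjoint (T j)) (hcomm : ∀ i j, Commute (T i) (T j)) {N : ℕ}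
    {x : ℕ → EuclideanSpace ℝ (Fin n)} {r : ℕ → ℝ} (hr : ∀ l, 0 ≤ r l)
    (hcov : jointSpectrum T ⊆ ⋃ l ∈ Finset.range N, Metric.ball (x l) (r l)) :
    ∃ f : ℕ → H →L[ℂ] H, f 0 = 1 ∧ (∀ k, IsStarProjection (f k)) ∧
      (∀ k, f k * f (k + 1) = f (k + 1)) ∧ (∀ k, N ≤ k → f k = 0) ∧
      (∀ k i, Commute (f k) (T i)) ∧
      ∀ k i v, ‖(T i - algebraMap ℂ (H →L[ℂ] H) (x k i : ℝ)) ((f k - f (k + 1)) v)‖ ≤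
        r k * ‖(f k - f (k + 1)) v‖ := by
  obtain ⟨g, d, G, hg, hd, hgd, hgg, hTg, hG0, hGN, hG⟩ :=
    exists_sub_squares_of_jointSpectrum_subset hT hcomm hcov
  choose p hp hgp hker hpc using fun l => (hg l).exists_kernel_projection
  -- `f k` is the product of `1 - p l` over `l < k`: what remains after removing the kernels of the
  -- first `k` operators `g l`.
  let f : ℕ → H →L[ℂ] H := fun k => Nat.rec 1 (fun k F => F * (1 - p k)) k
  have f0 : f 0 = 1 := rfl
  have fs : ∀ k, f (k + 1) = f k * (1 - p k) := fun _ => rfl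
  have fcomm : ∀ C, IsSelfAdjoint C → (∀ l, Commute C (g l)) → ∀ k, Commute C (f k) := by
    intro C hC hCg k
    induction k with
    | zero => exact Commute.one_right C
    | succ k ih =>
      rw [fs]
      exact ih.mul_right ((Commute.one_right C).sub_right (hpc k C hC (hCg k)))
  have fp : ∀ k l, Commute (p l) (f k) := fun k l =>
    fcomm _ (hp l).isSelfAdjoint (fun m => (hpc l _ (hg m) (hgg m l)).symm) k
  have fg : ∀ k l, Commute (g l) (f k) := fun k l => fcomm _ (hg l) (hgg l) k
  have fproj : ∀ k, IsStarProjection (f k) := by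
    intro k
    induction k with
    | zero => exact IsStarProjection.one _
    | succ k ih =>
      rw [fs]
      exact ih.mul_of_commute (hp k).one_sub ((Commute.one_right _).sub_right (fp k k).symm)
  -- Each step trades the factor `g k` for `1 - p k` by `hker`; at `k = N`, where `G N = 1`, this
  -- forces `f N = 0`.
  have fG : ∀ k ≤ N, G k * f k = 0 := by
    intro k
    induction k with
    | zero => intro _; rw [hG0, zero_mul]
    | succ k ih =>
      intro hk
      have h1 := ih (by omega)
      rw [hG k (by omega), mul_assoc, (fg k k).eq, ← mul_assoc] at h1
      rw [fs, ← mul_assoc]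
      exact hker k _ h1
  have fN : ∀ k, N ≤ k → f k = 0 := by
    intro k hk
    induction k, hk using Nat.le_induction with
    | base => simpa [hGN] using fG N le_rfl
    | succ k _ ih => rw [fs, ih, zero_mul]
  refine ⟨f, f0, fproj, fun k => ?_, fN, fun k i => (fcomm _ (hT i) (hTg i) k).symm, ?_⟩
  · rw [fs, ← mul_assoc, (fproj k).isIdempotentElem.eq]
  · intro k i v
    have hfe : f k - f (k + 1) = p k * f k := by
      rw [fs, mul_sub, mul_one, sub_sub_cancel, (fp k k).eq]
    set w := (f k - f (k + 1)) v with hw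
    have hgw : g k w = 0 := by
      have : g k * (f k - f (k + 1)) = 0 := by rw [hfe, ← mul_assoc, hgp, zero_mul]
      exact congr($this v)
    let S : Fin n → H →L[ℂ] H := fun i => T i - algebraMap ℂ (H →L[ℂ] H) (x k i : ℝ)
    have hS : ∀ i, IsSelfAdjoint (S i) := fun i =>
      (hT i).sub (IsSelfAdjoint.algebraMap _ (Complex.conj_ofReal _))
    -- The quadratic form of `hgd k` at `w`. Since `g k w = 0`, the right side is nonpositive.
    have h1 : ∑ i, ‖S i w‖ ^ 2 - r k ^ 2 * ‖w‖ ^ 2 = ‖g k w‖ ^ 2 - ‖d k w‖ ^ 2 := by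
      have h2 := congr(RCLike.re (inner ℂ ($(hgd k) w) w))
      simp only [sub_apply, sum_apply, inner_sub_left, sum_inner, map_sub, map_sum,
        (hg k).re_inner_mul_self, (hd k).re_inner_mul_self] at h2
      rw [h2]
      congr 1
      · refine Finset.sum_congr rfl fun i _ => ?_
        rw [← (hS i).re_inner_mul_self, ← pow_two]
      · rw [Algebra.algebraMap_eq_smul_one, smul_apply, one_apply_eq_self,
          inner_smul_left, Complex.conj_ofReal, ← inner_self_eq_norm_sq (𝕜 := ℂ)]
        exact (RCLike.re_ofReal_mul _ _).symm
    have h2 : ‖S i w‖ ^ 2 ≤ ∑ i, ‖S i w‖ ^ 2 :=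
      Finset.single_le_sum (f := fun i => ‖S i w‖ ^ 2) (fun i _ => sq_nonneg _) (Finset.mem_univ i)
    refine le_of_sq_le_sq ?_ (mul_nonneg (hr k) (norm_nonneg _))
    rw [hgw, norm_zero] at h1
    rw [mul_pow]
    nlinarith [sq_nonneg ‖d k w‖]

end Flag

/-! ### The projection attached to a flag and its commutators. -/

section Compression

variable {H : Type*} [NormedAddCommGroup H] [InnerProductSpace ℂ H] [CompleteSpace H]

theorem norm_sq_add_of_star_mul_eq_zero {A B : H →L[ℂ] H} (h : star A * B = 0) (u w : H) :
    ‖A u + B w‖ ^ 2 = ‖A u‖ ^ 2 + ‖B w‖ ^ 2 := by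
  have h0 : inner ℂ (A u) (B w) = 0 := by
    rw [← ContinuousLinearMap.adjoint_inner_right, ← ContinuousLinearMap.star_eq_adjoint,
      ← mul_apply_eq_comp, h, zero_apply, inner_zero_right]
  simpa only [sq] using norm_add_sq_eq_norm_sq_add_norm_sq_of_inner_eq_zero _ _ h0

theorem IsStarProjection.norm_sq_eq {P : H →L[ℂ] H} (hP : IsStarProjection P) (u : H) :
    ‖u‖ ^ 2 = ‖P u‖ ^ 2 + ‖(1 - P) u‖ ^ 2 := by
  have h : star P * (1 - P) = 0 := by rw [hP.isSelfAdjoint.star_eq, hP.mul_one_sub_self]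
  rw [← norm_sq_add_of_star_mul_eq_zero h u u]
  simp

/-- The commutator of an operator with a projection has at most the norm of the operator, on any
subspace reducing the projection. -/
theorem IsStarProjection.norm_commutator_apply_le {P e S : H →L[ℂ] H} (hP : IsStarProjection P)
    (hPe : Commute P e) {r : ℝ} (hr : 0 ≤ r) (hS : ∀ w, ‖S (e w)‖ ≤ r * ‖e w‖) (v : H) :
    ‖(P * S - S * P) (e v)‖ ≤ r * ‖e v‖ := by
  -- Only the two off-diagonal corners survive. Their ranges are orthogonal and they act on
  -- orthogonal parts of the vector, so the norm is a maximum instead of a sum and stays below `r`.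
  have hdec : (P * S - S * P) (e v) = P (S (e ((1 - P) v))) + (1 - P) (-(S (e (P v)))) := by
    have h1 : P * S - S * P = P * S * (1 - P) - (1 - P) * S * P := by noncomm_ring
    have h2 : (1 - P) * e = e * (1 - P) := ((Commute.one_left e).sub_left hPe).eq
    have h3 : (P * S - S * P) * e = P * (S * (e * (1 - P))) - (1 - P) * (S * (e * P)) := by
      rw [h1, ← h2, ← hPe.eq]
      noncomm_ring
    have h4 := congr($h3 v)
    rw [map_neg]
    exact h4.trans (sub_eq_add_neg _ _)
  have hsq : ‖(P * S - S * P) (e v)‖ ^ 2 ≤ (r * ‖e v‖) ^ 2 := by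
    have h0 : star P * (1 - P) = 0 := by rw [hP.isSelfAdjoint.star_eq, hP.mul_one_sub_self]
    have b1 : ‖P (S (e ((1 - P) v)))‖ ≤ r * ‖e ((1 - P) v)‖ := by
      refine le_trans ?_ (hS _)
      refine le_of_sq_le_sq ?_ (norm_nonneg _)
      rw [hP.norm_sq_eq (S _)]
      exact le_add_of_nonneg_right (sq_nonneg _)
    have b2 : ‖(1 - P) (-(S (e (P v))))‖ ≤ r * ‖e (P v)‖ := by
      refine le_trans ?_ (hS _)
      rw [map_neg, norm_neg]
      refine le_of_sq_le_sq ?_ (norm_nonneg _)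
      rw [hP.norm_sq_eq (S _)]
      exact le_add_of_nonneg_left (sq_nonneg _)
    have e1 : e (P v) = P (e v) := congr($(hPe.eq.symm) v)
    have e2 : e ((1 - P) v) = (1 - P) (e v) :=
      congr($(((Commute.one_left e).sub_left hPe).eq.symm) v)
    rw [hdec, norm_sq_add_of_star_mul_eq_zero h0, mul_pow, hP.norm_sq_eq (e v), ← e1, ← e2, mul_add,
      ← mul_pow, ← mul_pow, add_comm ((r * ‖e (P v)‖) ^ 2)]
    gcongr
  exact le_of_sq_le_sq hsq (by positivity)

/-- A bound for an operator on the successive differences of a decreasing flag of projections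
gives a bound on the members of the flag. -/
theorem norm_apply_flag_le {f : ℕ → H →L[ℂ] H} (hf : ∀ k, IsStarProjection (f k))
    (hdec : ∀ k, f k * f (k + 1) = f (k + 1)) {N : ℕ} (hN : ∀ k, N ≤ k → f k = 0)
    {r : ℕ → ℝ} (hr : ∀ k, 0 ≤ r k) (hanti : Antitone r) {S : H →L[ℂ] H}
    (hS : ∀ k, Commute (f k) S)
    (hb : ∀ k v, ‖S ((f k - f (k + 1)) v)‖ ≤ r k * ‖(f k - f (k + 1)) v‖) (k : ℕ) (v : H) :
    ‖S (f k v)‖ ≤ r k * ‖f k v‖ := by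
  -- Downward induction on `k`, starting from `f k = 0` for `k ≥ N`.
  suffices ∀ m k, N ≤ k + m → ∀ v, ‖S (f k v)‖ ≤ r k * ‖f k v‖ from this N k (by omega) v
  intro m
  induction m with
  | zero =>
    intro k hk v
    simp [hN k hk]
  | succ m ih =>
    intro k hk v
    have h0 : star (f k - f (k + 1)) * f (k + 1) = 0 := by
      rw [star_sub, (hf k).isSelfAdjoint.star_eq, (hf (k + 1)).isSelfAdjoint.star_eq, sub_mul, hdec,
        (hf (k + 1)).isIdempotentElem.eq, sub_self]
    have h1 : f k v = (f k - f (k + 1)) v + f (k + 1) v := by simp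
    have h2 : ‖f k v‖ ^ 2 = ‖(f k - f (k + 1)) v‖ ^ 2 + ‖f (k + 1) v‖ ^ 2 := by
      rw [← norm_sq_add_of_star_mul_eq_zero h0, ← h1]
    have c1 : S ((f k - f (k + 1)) v) = (f k - f (k + 1)) (S v) :=
      congr($(((hS k).sub_left (hS (k + 1))).eq.symm) v)
    have c2 : S (f (k + 1) v) = f (k + 1) (S v) := congr($((hS (k + 1)).eq.symm) v)
    have h3 : ‖S (f k v)‖ ^ 2 = ‖S ((f k - f (k + 1)) v)‖ ^ 2 + ‖S (f (k + 1) v)‖ ^ 2 := by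
      rw [c1, c2, ← norm_sq_add_of_star_mul_eq_zero h0, ← c1, ← c2, ← map_add, ← h1]
    have h4 : ‖S (f (k + 1) v)‖ ≤ r k * ‖f (k + 1) v‖ :=
      (ih (k + 1) (by omega) v).trans
        (mul_le_mul_of_nonneg_right (hanti (Nat.le_succ k)) (norm_nonneg _))
    refine le_of_sq_le_sq ?_ (mul_nonneg (hr k) (norm_nonneg _))
    rw [h3, mul_pow, h2, mul_add, ← mul_pow, ← mul_pow]
    have h5 := hb k v
    gcongr

/-- The projection onto the span of the components of a vector along the differences of a
decreasing flag of projections. -/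
theorem exists_projection_of_flag {f : ℕ → H →L[ℂ] H} (hf0 : f 0 = 1)
    (hf : ∀ k, IsStarProjection (f k)) (hdec : ∀ k, f k * f (k + 1) = f (k + 1)) {N : ℕ}
    (hN : ∀ k, N ≤ k → f k = 0) (ξ : H) :
    ∃ P : H →L[ℂ] H, IsStarProjection P ∧ P ξ = ξ ∧ (∀ k, Commute P (f k)) ∧
      ∀ k : ℕ, LinearMap.rank ((P * (1 - f k) : H →L[ℂ] H) : H →ₗ[ℂ] H) ≤ k := by
  classical
  have hle : ∀ k l, k ≤ l → f k * f l = f l := by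
    intro k l hkl
    induction l, hkl using Nat.le_induction with
    | base => exact (hf k).isIdempotentElem.eq
    | succ l _ ih => rw [← hdec l, ← mul_assoc, ih]
  have hle' : ∀ k l, k ≤ l → f l * f k = f l := by
    intro k l hkl
    have := congrArg star (hle k l hkl)
    rwa [star_mul, (hf k).isSelfAdjoint.star_eq, (hf l).isSelfAdjoint.star_eq] at this
  let w : ℕ → H := fun l => (f l - f (l + 1)) ξ
  have hw : ∀ k l, f k (w l) = if k ≤ l then w l else 0 := by
    intro k l
    split_ifs with h
    · have : f k * (f l - f (l + 1)) = f l - f (l + 1) := by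
        rw [mul_sub, hle _ _ h, hle _ _ (h.trans (Nat.le_succ l))]
      exact congr($this ξ)
    · have : f k * (f l - f (l + 1)) = 0 := by
        rw [mul_sub, hle' _ _ (by omega), hle' _ _ (by omega), sub_self]
      exact congr($this ξ)
  let K : Submodule ℂ H := Submodule.span ℂ ((Finset.range N).image w : Finset H)
  have hinv : ∀ k, ∀ v ∈ K, f k v ∈ K := by
    intro k
    suffices K ≤ K.comap (f k : H →ₗ[ℂ] H) from fun v hv => this hv
    refine Submodule.span_le.mpr fun v hv => ?_
    obtain ⟨l, hl, rfl⟩ := Finset.mem_image.mp hv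
    change f k (w l) ∈ K
    rw [hw]
    split_ifs
    · exact Submodule.subset_span hv
    · exact K.zero_mem
  have hcomm : ∀ k, Commute K.starProjection (f k) := fun k =>
    (commute_starProjection_of_invariant (hinv k)
      (by rw [(hf k).isSelfAdjoint.star_eq]; exact hinv k)).symm
  refine ⟨K.starProjection, isStarProjection_starProjection, ?_, hcomm, fun k => ?_⟩
  · rw [Submodule.starProjection_eq_self_iff]
    have h1 : ∑ l ∈ Finset.range N, w l = ξ := by
      have := congr($(Finset.sum_range_sub' f N) ξ)
      rw [hf0, hN N le_rfl, sub_zero, sum_apply] at this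
      exact this
    rw [← h1]
    exact Submodule.sum_mem _ fun l hl => Submodule.subset_span (Finset.mem_image_of_mem w hl)
  · let L : Submodule ℂ H := Submodule.span ℂ ((Finset.range k).image w : Finset H)
    -- `1 - f k` kills `w l` for `l ≥ k` and fixes the `k` vectors `w l` with `l < k`.
    have h1 : ∀ v ∈ K, (1 - f k) v ∈ L := by
      suffices K ≤ L.comap ((1 - f k : H →L[ℂ] H) : H →ₗ[ℂ] H) from fun v hv => this hv
      refine Submodule.span_le.mpr fun v hv => ?_
      obtain ⟨l, hl, rfl⟩ := Finset.mem_image.mp hv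
      change (1 - f k) (w l) ∈ L
      rw [sub_apply, one_apply_eq_self, hw]
      split_ifs with h
      · rw [sub_self]
        exact L.zero_mem
      · rw [sub_zero]
        exact Submodule.subset_span (Finset.mem_image_of_mem w (Finset.mem_range.mpr (by omega)))
    have h2 : LinearMap.range ((K.starProjection * (1 - f k) : H →L[ℂ] H) : H →ₗ[ℂ] H) ≤ L := by
      rw [((Commute.one_right _).sub_right (hcomm k)).eq]
      rintro _ ⟨v, rfl⟩
      exact h1 _ (K.starProjection_apply_mem v)
    refine (Submodule.rank_mono h2).trans ((rank_span_finset_le _).trans ?_)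
    exact_mod_cast Finset.card_image_le.trans_eq (Finset.card_range k)

/-- A finite cover of the joint spectrum by balls with decreasing radii yields a finite rank
projection fixing a given vector, whose commutators with the operators have approximation numbers
dominated by `r₀, r₀, r₁, r₁, …`. -/
theorem exists_projection_of_cover {n : ℕ} {T : Fin n → H →L[ℂ] H}
    (hT : ∀ j, IsSelfAdjoint (T j)) (hcomm : ∀ i j, Commute (T i) (T j)) (ξ : H) {N : ℕ}
    {x : ℕ → EuclideanSpace ℝ (Fin n)} {r : ℕ → ℝ} (hr : ∀ l, 0 ≤ r l) (hanti : Antitone r)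
    (hcov : jointSpectrum T ⊆ ⋃ l ∈ Finset.range N, Metric.ball (x l) (r l)) :
    ∃ P : H →L[ℂ] H, IsStarProjection P ∧ P ξ = ξ ∧
      LinearMap.rank (P : H →ₗ[ℂ] H) ≤ N ∧
      ∀ i (k : ℕ), ∃ L : H →L[ℂ] H, LinearMap.rank (L : H →ₗ[ℂ] H) ≤ (2 * k : ℕ) ∧
        ‖(P * T i - T i * P) - L‖ ≤ r k := by
  obtain ⟨f, hf0, hf, hdec, hN, hfT, hb⟩ := exists_spectral_flag hT hcomm hr hcov
  obtain ⟨P, hP, hPξ, hPf, hrank⟩ := exists_projection_of_flag hf0 hf hdec hN ξ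
  -- The approximant keeps the first `k` blocks of the commutator, each of rank at most `2`.
  refine ⟨P, hP, hPξ, ?_, fun i k => ⟨(P * T i - T i * P) * (1 - f k), ?_, ?_⟩⟩
  · simpa [hN N le_rfl] using hrank N
  · have h1 : (P * T i - T i * P) * (1 - f k) =
        P * (1 - f k) * T i + (-T i) * (P * (1 - f k)) := by
      have := ((Commute.one_left (T i)).sub_left (hfT k i)).eq
      rw [mul_assoc P, this]
      noncomm_ring
    rw [h1]
    refine (LinearMap.rank_add_le ((P * (1 - f k) : H →L[ℂ] H) ∘ₗ (T i : H →ₗ[ℂ] H))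
      (((-T i : H →L[ℂ] H) : H →ₗ[ℂ] H) ∘ₗ (P * (1 - f k) : H →L[ℂ] H))).trans ?_
    refine (add_le_add ((LinearMap.rank_comp_le_left _ _).trans (hrank k))
      ((LinearMap.rank_comp_le_right _ _).trans (hrank k))).trans_eq ?_
    rw [two_mul, Nat.cast_add]
  · have hCf : ∀ k, Commute (f k) (P * T i - T i * P) := fun k =>
      (((hPf k).symm.mul_right (hfT k i))).sub_right ((hfT k i).mul_right (hPf k).symm)
    have hbound : ∀ k v, ‖(P * T i - T i * P) ((f k - f (k + 1)) v)‖ ≤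
        r k * ‖(f k - f (k + 1)) v‖ := by
      intro k v
      have h1 := hP.norm_commutator_apply_le ((hPf k).sub_right (hPf (k + 1))) (hr k)
        (hb k i) v
      -- Scalars drop out of commutators, so the centre `x k` may be subtracted block by block.
      have h2 : P * (T i - algebraMap ℂ (H →L[ℂ] H) (x k i : ℝ)) -
          (T i - algebraMap ℂ (H →L[ℂ] H) (x k i : ℝ)) * P = P * T i - T i * P := by
        rw [mul_sub, sub_mul, Algebra.commutes, sub_sub_sub_cancel_right]
      rwa [h2] at h1
    refine ContinuousLinearMap.opNorm_le_bound _ (hr k) fun v => ?_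
    have h1 : (P * T i - T i * P) - (P * T i - T i * P) * (1 - f k) =
        (P * T i - T i * P) * f k := by noncomm_ring
    rw [h1]
    refine (norm_apply_flag_le hf hdec hN hr hanti hCf hbound k v).trans ?_
    refine mul_le_mul_of_nonneg_left ?_ (hr k)
    exact ((f k).le_opNorm v).trans (mul_le_of_le_one_left (norm_nonneg v) (hf k).norm_le)

end Compression

/-! ### Finite covers with decreasing radii. -/

section Cover

theorem NormingFunction.ofReal_toFun_sum_single_le_eval (Φ : NormingFunction) {r : ℕ → ℝ}
    (t : Finset ℕ) :
    ENNReal.ofReal (Φ.toFun (∑ j ∈ t, Finsupp.single j (r j))) ≤ Φ.eval r := by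
  classical
  obtain ⟨M, hM⟩ := t.exists_nat_subset_range
  refine le_trans (ENNReal.ofReal_le_ofReal (Φ.toFun_mono fun i => ?_))
    (le_iSup (fun M => ENNReal.ofReal
      (Φ.toFun (Finsupp.indicator (Finset.range M) fun i _ => r i))) M)
  rw [Finsupp.finsetSum_apply, Finsupp.indicator_apply]
  simp only [Finsupp.single_apply, Finset.sum_ite_eq']
  split_ifs with h1 h2
  · exact le_rfl
  · exact absurd (hM h1) h2
  · simp
  · simp

/-- A compact set has a finite cover by small balls, listed with decreasing radii, whose norm is
close to the content of the set. -/
theorem exists_finite_antitone_cover (Φ : NormingFunction) {n : ℕ}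
    {E : Set (EuclideanSpace ℝ (Fin n))} (hE : IsCompact E) (hfin : hausdorffContent Φ E ≠ ⊤)
    {ε : ℝ} (hε : 0 < ε) :
    ∃ (N : ℕ) (x : ℕ → EuclideanSpace ℝ (Fin n)) (r : ℕ →₀ ℝ), (∀ l, 0 ≤ r l) ∧ Antitone r ∧
      r 0 ≤ ε ∧ E ⊆ ⋃ l ∈ Finset.range N, Metric.ball (x l) (r l) ∧
      ENNReal.ofReal (Φ.toFun r) ≤ hausdorffContent Φ E + ENNReal.ofReal ε := by
  classical
  have h1 : coveringContent Φ ε E < hausdorffContent Φ E + ENNReal.ofReal ε :=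
    (le_iSup₂ (f := fun (ε : ℝ) (_ : 0 < ε) => coveringContent Φ ε E) ε hε).trans_lt
      (ENNReal.lt_add_right hfin (by simpa using hε))
  obtain ⟨_, ⟨x, r, hr, hcov, rfl⟩, hlt⟩ := sInf_lt_iff.mp h1
  obtain ⟨t, ht⟩ := hE.elim_finite_subcover _ (fun j => Metric.isOpen_ball) hcov
  let N := t.card
  let e : Fin N ≃ t := t.equivFin.symm
  let σ : Equiv.Perm (Fin N) := Tuple.sort fun l => -r (e l)
  have hσ : Antitone fun l => r (e (σ l)) := fun a b hab =>
    neg_le_neg_iff.mp (Tuple.monotone_sort (fun l => -r (e l)) hab)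
  let ρ : ℕ →₀ ℝ := ∑ l : Fin N, Finsupp.single (l : ℕ) (r (e (σ l)))
  have hρ : ∀ l : Fin N, ρ l = r (e (σ l)) := by
    intro l
    simp [ρ, Finsupp.finsetSum_apply, Finsupp.single_apply, Fin.val_inj]
  have hρ' : ∀ l, N ≤ l → ρ l = 0 := by
    intro l hl
    simp only [ρ, Finsupp.finsetSum_apply]
    exact Finset.sum_eq_zero fun i _ => Finsupp.single_eq_of_ne (by omega)
  have hpos : ∀ l, 0 ≤ ρ l := by
    intro l
    rcases lt_or_ge l N with h | h
    · rw [hρ ⟨l, h⟩]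
      exact (hr _).1.le
    · rw [hρ' l h]
  -- The value `0` beyond `N` is immaterial, since `ρ` vanishes there.
  let ι : ℕ → ℕ := fun l => if h : l < N then e (σ ⟨l, h⟩) else 0
  have hι : ∀ l : Fin N, ι l = e (σ l) := fun l => dif_pos l.2
  refine ⟨N, fun l => x (ι l), ρ, hpos, ?_, ?_, ?_, ?_⟩
  · intro a b hab
    rcases lt_or_ge b N with h | h
    · rw [hρ ⟨b, h⟩, hρ ⟨a, hab.trans_lt h⟩]
      exact hσ hab
    · rw [hρ' b h]
      exact hpos a
  · rcases lt_or_ge 0 N with h | h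
    · rw [hρ ⟨0, h⟩]
      exact (hr _).2.le
    · rw [hρ' 0 h]
      exact hε.le
  · intro y hy
    obtain ⟨j, hj, hyj⟩ := Set.mem_iUnion₂.mp (ht hy)
    let l : Fin N := σ.symm (e.symm ⟨j, hj⟩)
    have hl : ((e (σ l) : t) : ℕ) = j := by simp [l]
    refine Set.mem_iUnion₂.mpr ⟨l, Finset.mem_range.mpr l.2, ?_⟩
    simp only [hρ l, hι l, hl]
    exact hyj
  -- `ι` carries `ρ` back to the unsorted radii of the subcover, so sorting leaves the norm
  -- unchanged.
  · have h2 : ρ.mapDomain ι = ∑ j ∈ t, Finsupp.single j (r j) := by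
      rw [Finsupp.mapDomain_finsetSum]
      simp only [Finsupp.mapDomain_single, hι]
      rw [← Finset.sum_coe_sort t]
      exact (σ.trans e).sum_comp fun j : t => Finsupp.single (j : ℕ) (r j)
    have h3 : Set.InjOn ι (Set.Iio N) := by
      intro a ha b hb hab
      have := (hι ⟨a, ha⟩).symm.trans (hab.trans (hι ⟨b, hb⟩))
      exact congrArg Fin.val (σ.injective (e.injective (Subtype.ext this)))
    have h4 : (ρ.support : Set ℕ) ⊆ Set.Iio N := fun l hl => by
      by_contra h
      exact Finsupp.mem_support_iff.mp hl (hρ' l (not_lt.mp h))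
    rw [← Φ.toFun_mapDomain (h3.mono h4), h2]
    exact (Φ.ofReal_toFun_sum_single_le_eval t).trans hlt.le

end Cover

/-! ### Strong convergence and enlargement of projections. -/

section ApproximateUnit

variable {H : Type*} [NormedAddCommGroup H] [InnerProductSpace ℂ H]

/-- Contractions fixing a cyclic vector and asymptotically commuting with the operators converge
strongly to the identity. -/
theorem IsCyclicVector.tendsto_apply {n : ℕ} {T : Fin n → H →L[ℂ] H} {ξ : H}
    (hξ : IsCyclicVector T ξ) {P : ℕ → H →L[ℂ] H} (hP : ∀ m, ‖P m‖ ≤ 1) (hPξ : ∀ m, P m ξ = ξ)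
    (hPT : ∀ i, Tendsto (fun m => P m * T i - T i * P m) atTop (𝓝 0)) (v : H) :
    Tendsto (fun m => P m v) atTop (𝓝 v) := by
  have hadj : ∀ a ∈ Algebra.adjoin ℂ (Set.range T),
      Tendsto (fun m => P m * a - a * P m) atTop (𝓝 0) := by
    intro a ha
    induction ha using Algebra.adjoin_induction with
    | mem a ha =>
      obtain ⟨i, rfl⟩ := ha
      exact hPT i
    | algebraMap c => simp [← Algebra.commutes c]
    | add a b _ _ iha ihb =>
      have := iha.add ihb
      rw [add_zero] at this
      refine this.congr fun m => ?_
      noncomm_ring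
    | mul a b _ _ iha ihb =>
      have := (iha.mul_const b).add (ihb.const_mul a)
      rw [zero_mul, mul_zero, add_zero] at this
      refine this.congr fun m => ?_
      noncomm_ring
  -- As `P m` fixes `ξ`, `P m (a ξ) = [P m, a] ξ + a ξ`.
  have hdense : ∀ a ∈ Algebra.adjoin ℂ (Set.range T),
      Tendsto (fun m => P m (a ξ)) atTop (𝓝 (a ξ)) := by
    intro a ha
    have h1 := ((ContinuousLinearMap.apply ℂ H ξ).continuous.tendsto 0).comp (hadj a ha)
    have h2 := h1.add_const (a ξ)
    simp only [map_zero, zero_add] at h2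
    refine h2.congr fun m => ?_
    simp [hPξ]
  rw [Metric.tendsto_atTop]
  intro ε hε
  obtain ⟨_, hy, a, ha, rfl⟩ := Metric.dense_iff.mp hξ v (ε / 3) (by positivity)
  obtain ⟨M, hM⟩ := Metric.tendsto_atTop.mp (hdense a ha) (ε / 3) (by positivity)
  refine ⟨M, fun m hm => ?_⟩
  have h1 : dist (P m v) (P m (a ξ)) ≤ dist v (a ξ) := by
    rw [dist_eq_norm, dist_eq_norm, ← map_sub]
    exact ((P m).le_opNorm _).trans (mul_le_of_le_one_left (norm_nonneg _) (hP m))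
  have h2 := hM m hm
  rw [Metric.mem_ball, dist_comm] at hy
  calc dist (P m v) v ≤ dist (P m v) (P m (a ξ)) + dist (P m (a ξ)) (a ξ) + dist (a ξ) v :=
        dist_triangle4 _ _ _ _
    _ < ε := by rw [dist_comm (a ξ) v]; linarith

/-- On a finite dimensional space strong convergence is norm convergence: expand in an orthonormal
basis. -/
theorem tendsto_one_sub_mul_starProjection {P : ℕ → H →L[ℂ] H}
    (hP : ∀ v, Tendsto (fun m => P m v) atTop (𝓝 v)) (K : Submodule ℂ H)
    [FiniteDimensional ℂ K] :
    Tendsto (fun m => (1 - P m) * K.starProjection) atTop (𝓝 0) := by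
  let b := stdOrthonormalBasis ℂ K
  have hK : ∀ v, K.starProjection v = ∑ i, inner ℂ (b i : H) v • (b i : H) := by
    intro v
    rw [b.starProjection_eq_sum_rankOne, sum_apply]
    simp
  have hlim : Tendsto (fun m => ∑ i, ‖(1 - P m) (b i)‖) atTop (𝓝 0) := by
    rw [← Finset.sum_const_zero (ι := Fin (Module.finrank ℂ K)) (M := ℝ) (s := Finset.univ)]
    refine tendsto_finsetSum _ fun i _ => ?_
    have := (tendsto_const_nhds (x := (b i : H))).sub (hP (b i))
    rw [sub_self] at this
    simpa using this.norm
  refine squeeze_zero_norm (fun m => ?_) hlim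
  refine ContinuousLinearMap.opNorm_le_bound _ (Finset.sum_nonneg fun i _ => norm_nonneg _) ?_
  intro v
  rw [mul_apply_eq_comp, hK, map_sum, Finset.sum_mul]
  refine norm_sum_le_of_le _ fun i _ => ?_
  rw [map_smul, norm_smul, mul_comm]
  refine mul_le_mul_of_nonneg_left ?_ (norm_nonneg _)
  refine (norm_inner_le_norm _ _).trans (mul_le_of_le_one_left (norm_nonneg v) ?_)
  exact (b.norm_eq_one i).le

theorem rank_commutator_le {D S : H →L[ℂ] H} {d : ℕ}
    (hD : LinearMap.rank (D : H →ₗ[ℂ] H) ≤ d) :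
    LinearMap.rank ((D * S - S * D : H →L[ℂ] H) : H →ₗ[ℂ] H) ≤ (2 * d : ℕ) := by
  have h1 : D * S - S * D = D * S + (-S) * D := by noncomm_ring
  rw [h1]
  refine (LinearMap.rank_add_le ((D : H →ₗ[ℂ] H) ∘ₗ (S : H →ₗ[ℂ] H))
    (((-S : H →L[ℂ] H) : H →ₗ[ℂ] H) ∘ₗ (D : H →ₗ[ℂ] H))).trans ?_
  refine (add_le_add ((LinearMap.rank_comp_le_left _ _).trans hD)
    ((LinearMap.rank_comp_le_right _ _).trans hD)).trans_eq ?_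
  rw [two_mul, Nat.cast_add]

variable [CompleteSpace H]

/-- The norm of a commutator `[P + D, S]`, where `D` has rank at most `d` and the approximation
numbers of `[P, S]` are dominated by `r₀, r₀, r₁, r₁, …`. -/
theorem NormingFunction.opNorm_commutator_le (Φ : NormingFunction) {P D S : H →L[ℂ] H}
    {r : ℕ →₀ ℝ} {d : ℕ} (hD : LinearMap.rank (D : H →ₗ[ℂ] H) ≤ d)
    (hP : ∀ k : ℕ, ∃ L : H →L[ℂ] H, LinearMap.rank (L : H →ₗ[ℂ] H) ≤ (2 * k : ℕ) ∧
      ‖(P * S - S * P) - L‖ ≤ r k) :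
    Φ.opNorm ((P + D) * S - S * (P + D)) ≤
      ENNReal.ofReal ((2 * d : ℕ) * ‖(P + D) * S - S * (P + D)‖ + 2 * Φ.toFun r) := by
  set X := (P + D) * S - S * (P + D) with hX
  -- Adding `[D, S]`, of rank at most `2 * d`, to the approximant `L` leaves the error unchanged and
  -- shifts the index by `2 * d`. The first `2 * d` singular values are bounded only by `‖X‖`.
  have key : ∀ k j, 2 * k + 2 * d ≤ j → singularValue X j ≤ r k := by
    intro k j hj
    obtain ⟨L, hL, hLr⟩ := hP k
    have h1 : LinearMap.rank ((L + (D * S - S * D) : H →L[ℂ] H) : H →ₗ[ℂ] H) ≤ j := by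
      refine (LinearMap.rank_add_le (L : H →ₗ[ℂ] H)
        ((D * S - S * D : H →L[ℂ] H) : H →ₗ[ℂ] H)).trans ?_
      refine (add_le_add hL (rank_commutator_le hD)).trans ?_
      exact_mod_cast hj
    refine (singularValue_le_norm_sub X _ h1).trans ?_
    have h2 : X - (L + (D * S - S * D)) = (P * S - S * P) - L := by
      rw [hX]
      noncomm_ring
    rwa [h2]
  refine Φ.eval_le_of_doubled (singularValue_nonneg X) (fun j _ => ?_) (fun k => key k _ le_rfl)
    fun k => key k _ (by omega)
  simpa using singularValue_le_norm_sub X 0 (j := j) (by simp [LinearMap.rank_zero])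

/-- `A = Q A Q ≤ Q 1 Q = Q`. -/
theorem le_starProjection_range {A : H →L[ℂ] H} (h0 : 0 ≤ A) (h1 : A ≤ 1)
    [FiniteDimensional ℂ (LinearMap.range (A : H →ₗ[ℂ] H))] :
    A ≤ (LinearMap.range (A : H →ₗ[ℂ] H)).starProjection := by
  set Q := (LinearMap.range (A : H →ₗ[ℂ] H)).starProjection with hQ
  have hp : IsStarProjection Q := isStarProjection_starProjection
  have h2 : Q * A = A := by
    ext v
    exact Submodule.starProjection_eq_self_iff.mpr ⟨v, rfl⟩
  have h3 : A * Q = A := by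
    have := congrArg star h2
    rwa [star_mul, hp.isSelfAdjoint.star_eq, (IsSelfAdjoint.of_nonneg h0).star_eq] at this
  have h4 := star_left_conjugate_le_conjugate h1 Q
  rwa [hp.isSelfAdjoint.star_eq, h2, h3, mul_one, hp.isIdempotentElem.eq] at h4

/-- Enlarging a projection `P` by a finite rank projection `Q`. -/
theorem IsStarProjection.add_compression {P Q : H →L[ℂ] H} (hP : IsStarProjection P)
    (hQ : IsStarProjection Q) :
    Q ≤ Q + (1 - Q) * P * (1 - Q) ∧ Q + (1 - Q) * P * (1 - Q) ≤ 1 ∧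
      Q + (1 - Q) * P * (1 - Q) = P + ((1 - P) * Q + Q * ((1 - P) * (1 - Q))) ∧
      ‖(1 - P) * Q + Q * ((1 - P) * (1 - Q))‖ ≤ 2 * ‖(1 - P) * Q‖ := by
  have hs : star (1 - Q) = 1 - Q := hQ.one_sub.isSelfAdjoint.star_eq
  refine ⟨le_add_of_nonneg_right ?_, ?_, ?_, ?_⟩
  · have := star_left_conjugate_nonneg hP.nonneg (1 - Q)
    rwa [hs] at this
  · have := star_left_conjugate_le_conjugate hP.le_one (1 - Q)
    rw [hs, mul_one, hQ.one_sub.isIdempotentElem.eq] at this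
    calc Q + (1 - Q) * P * (1 - Q) ≤ Q + (1 - Q) := add_le_add le_rfl this
      _ = 1 := by abel
  · have h := hQ.isIdempotentElem.eq
    have h' : Q * (1 - Q) = 0 := hQ.mul_one_sub_self
    have e1 : Q * ((1 - P) * (1 - Q)) = Q * (1 - Q) - Q * P * (1 - Q) := by noncomm_ring
    rw [e1, h']
    noncomm_ring
  · have h1 : ‖Q * (1 - P)‖ = ‖(1 - P) * Q‖ := by
      rw [← norm_star, star_mul, hQ.isSelfAdjoint.star_eq, hP.one_sub.isSelfAdjoint.star_eq]
    refine (norm_add_le _ _).trans ?_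
    rw [two_mul, ← mul_assoc]
    refine add_le_add le_rfl ((norm_mul_le _ _).trans ?_)
    rw [h1]
    exact mul_le_of_le_one_right (norm_nonneg _) hQ.one_sub.norm_le

end ApproximateUnit

/-! ### Construction of the approximate unit and conclusion. -/

section Main

variable {H : Type*} [NormedAddCommGroup H] [InnerProductSpace ℂ H] [CompleteSpace H]

/-- Projections converging strongly to the identity, whose commutators with the operators are
small, allow every finite rank contraction to be enlarged to one with small commutators. -/
theorem exists_le_opNorm_commutator_le (Φ : NormingFunction) {n : ℕ} {T : Fin n → H →L[ℂ] H}
    {U : ℝ≥0∞} {ε : ℕ → ℝ} (hε0 : ∀ m, 0 ≤ ε m) (hε : Tendsto ε atTop (𝓝 0)) {P : ℕ → H →L[ℂ] H}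
    {r : ℕ → ℕ →₀ ℝ} (hP : ∀ m, IsStarProjection (P m))
    (hfin : ∀ m, FiniteDimensional ℂ (LinearMap.range (P m : H →ₗ[ℂ] H)))
    (hP1 : ∀ v, Tendsto (fun m => P m v) atTop (𝓝 v))
    (hPT : ∀ i, Tendsto (fun m => P m * T i - T i * P m) atTop (𝓝 0))
    (hr : ∀ m, ENNReal.ofReal (Φ.toFun (r m)) ≤ U + ENNReal.ofReal (ε m))
    (hL : ∀ m i (k : ℕ), ∃ L : H →L[ℂ] H, LinearMap.rank (L : H →ₗ[ℂ] H) ≤ (2 * k : ℕ) ∧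
      ‖(P m * T i - T i * P m) - L‖ ≤ r m k)
    {A : H →L[ℂ] H} (hA0 : 0 ≤ A) (hA1 : A ≤ 1)
    (hAfin : FiniteDimensional ℂ (LinearMap.range (A : H →ₗ[ℂ] H)))
    {δ : ℝ} (hδ : 0 < δ) (M : ℕ) :
    ∃ A' : H →L[ℂ] H, 0 ≤ A' ∧ A' ≤ 1 ∧
      FiniteDimensional ℂ (LinearMap.range (A' : H →ₗ[ℂ] H)) ∧ A ≤ A' ∧
      (∃ m ≥ M, ‖A' - P m‖ ≤ δ) ∧
      ∀ i, Φ.opNorm (A' * T i - T i * A') ≤ 2 * U + ENNReal.ofReal δ := by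
  let K := LinearMap.range (A : H →ₗ[ℂ] H)
  let Q := K.starProjection
  have hQ : IsStarProjection Q := isStarProjection_starProjection
  let D : ℕ → H →L[ℂ] H := fun m => (1 - P m) * Q + Q * ((1 - P m) * (1 - Q))
  let B : ℕ → H →L[ℂ] H := fun m => Q + (1 - Q) * P m * (1 - Q)
  have hB : ∀ m, Q ≤ B m ∧ B m ≤ 1 ∧ B m = P m + D m ∧ ‖D m‖ ≤ 2 * ‖(1 - P m) * Q‖ := fun m =>
    (hP m).add_compression hQ
  let d := Module.finrank ℂ K
  have hQrank : LinearMap.rank (Q : H →ₗ[ℂ] H) ≤ d := by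
    have : LinearMap.range (Q : H →ₗ[ℂ] H) ≤ K := by
      rintro _ ⟨v, rfl⟩
      exact K.starProjection_apply_mem v
    exact (Submodule.rank_mono this).trans_eq (Module.finrank_eq_rank ℂ K).symm
  have hDrank : ∀ m, LinearMap.rank (D m : H →ₗ[ℂ] H) ≤ (2 * d : ℕ) := by
    intro m
    refine (LinearMap.rank_add_le (((1 - P m : H →L[ℂ] H) : H →ₗ[ℂ] H) ∘ₗ (Q : H →ₗ[ℂ] H))
      ((Q : H →ₗ[ℂ] H) ∘ₗ (((1 - P m) * (1 - Q) : H →L[ℂ] H) : H →ₗ[ℂ] H))).trans ?_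
    refine (add_le_add ((LinearMap.rank_comp_le_right _ _).trans hQrank)
      ((LinearMap.rank_comp_le_left _ _).trans hQrank)).trans_eq ?_
    rw [two_mul, Nat.cast_add]
  have hD0 : Tendsto D atTop (𝓝 0) := by
    have h1 := (tendsto_one_sub_mul_starProjection hP1 K).norm.const_mul 2
    rw [norm_zero, mul_zero] at h1
    exact squeeze_zero_norm (fun m => (hB m).2.2.2) h1
  have hX0 : ∀ i, Tendsto (fun m => (P m + D m) * T i - T i * (P m + D m)) atTop (𝓝 0) := by
    intro i
    have h1 := (hPT i).add ((hD0.mul_const (T i)).sub (hD0.const_mul (T i)))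
    rw [zero_mul, mul_zero, sub_zero, add_zero] at h1
    refine h1.congr fun m => ?_
    noncomm_ring
  -- `D m` has rank at most `2 * d`, its commutators at most `2 * (2 * d)`. As `d` depends only on
  -- `A`, this many singular values of vanishing size contribute nothing in the limit.
  have hsmall : ∀ᶠ m in atTop, ∀ i, ((2 * (2 * d) : ℕ) : ℝ) *
      ‖(P m + D m) * T i - T i * (P m + D m)‖ + 2 * ε m < δ := by
    refine eventually_all.mpr fun i => ?_
    have h1 := ((hX0 i).norm.const_mul ((2 * (2 * d) : ℕ) : ℝ)).add (hε.const_mul 2)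
    rw [norm_zero, mul_zero, mul_zero, add_zero] at h1
    exact h1.eventually (gt_mem_nhds hδ)
  have hDsmall : ∀ᶠ m in atTop, ‖D m‖ < δ := by
    have h1 := hD0.norm
    rw [norm_zero] at h1
    exact h1.eventually (gt_mem_nhds hδ)
  obtain ⟨m, h1, h2, hm⟩ := (hsmall.and (hDsmall.and (eventually_ge_atTop M))).exists
  obtain ⟨b1, b2, b3, -⟩ := hB m
  refine ⟨B m, hQ.nonneg.trans b1, b2, ?_, (le_starProjection_range hA0 hA1).trans b1,
    ⟨m, hm, ?_⟩, fun i => ?_⟩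
  · have := hfin m
    have hDfin : FiniteDimensional ℂ (LinearMap.range (D m : H →ₗ[ℂ] H)) :=
      Module.rank_lt_aleph0_iff.mp ((hDrank m).trans_lt (Cardinal.natCast_lt_aleph0))
    rw [b3]
    refine Submodule.finiteDimensional_of_le (S₂ := LinearMap.range (P m : H →ₗ[ℂ] H) ⊔
      LinearMap.range (D m : H →ₗ[ℂ] H)) ?_
    rintro _ ⟨v, rfl⟩
    exact Submodule.add_mem_sup ⟨v, rfl⟩ ⟨v, rfl⟩
  · rw [b3, add_sub_cancel_left]
    exact h2.le
  · rw [b3]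
    refine (Φ.opNorm_commutator_le (hDrank m) (hL m i)).trans ?_
    have hΦ := Φ.toFun_nonneg (r m)
    rw [ENNReal.ofReal_add (by positivity) (by positivity), ENNReal.ofReal_mul zero_le_two,
      ENNReal.ofReal_ofNat]
    calc _ ≤ ENNReal.ofReal (((2 * (2 * d) : ℕ) : ℝ) *
            ‖(P m + D m) * T i - T i * (P m + D m)‖) + 2 * (U + ENNReal.ofReal (ε m)) := by
          gcongr
          exact hr m
      _ = 2 * U + ENNReal.ofReal (((2 * (2 * d) : ℕ) : ℝ) *
            ‖(P m + D m) * T i - T i * (P m + D m)‖ + 2 * ε m) := by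
          have := hε0 m
          rw [ENNReal.ofReal_add (by positivity) (by positivity), ENNReal.ofReal_mul zero_le_two,
            ENNReal.ofReal_ofNat]
          ring
      _ ≤ 2 * U + ENNReal.ofReal δ := by
          gcongr
          exact (h1 i).le

theorem quasicentralModulus_le_of_projections (Φ : NormingFunction) {n : ℕ}
    {T : Fin n → H →L[ℂ] H} {U : ℝ≥0∞} {ε : ℕ → ℝ} (hε0 : ∀ m, 0 ≤ ε m)
    (hε : Tendsto ε atTop (𝓝 0)) {P : ℕ → H →L[ℂ] H} {r : ℕ → ℕ →₀ ℝ}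
    (hP : ∀ m, IsStarProjection (P m))
    (hfin : ∀ m, FiniteDimensional ℂ (LinearMap.range (P m : H →ₗ[ℂ] H)))
    (hP1 : ∀ v, Tendsto (fun m => P m v) atTop (𝓝 v))
    (hPT : ∀ i, Tendsto (fun m => P m * T i - T i * P m) atTop (𝓝 0))
    (hr : ∀ m, ENNReal.ofReal (Φ.toFun (r m)) ≤ U + ENNReal.ofReal (ε m))
    (hL : ∀ m i (k : ℕ), ∃ L : H →L[ℂ] H, LinearMap.rank (L : H →ₗ[ℂ] H) ≤ (2 * k : ℕ) ∧
      ‖(P m * T i - T i * P m) - L‖ ≤ r m k) :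
    quasicentralModulus Φ T ≤ 2 * U := by
  let G := {A : H →L[ℂ] H // 0 ≤ A ∧ A ≤ 1 ∧
    FiniteDimensional ℂ (LinearMap.range (A : H →ₗ[ℂ] H))}
  have hδ : ∀ M : ℕ, (0 : ℝ) < 1 / ((M : ℝ) + 1) := fun M => Nat.one_div_pos_of_nat
  have hstep : ∀ (M : ℕ) (A : G), ∃ A' : G, A.1 ≤ A'.1 ∧
      (∃ m ≥ M, ‖A'.1 - P m‖ ≤ 1 / ((M : ℝ) + 1)) ∧
      ∀ i, Φ.opNorm (A'.1 * T i - T i * A'.1) ≤ 2 * U + ENNReal.ofReal (1 / ((M : ℝ) + 1)) := by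
    rintro M ⟨A, hA0, hA1, hAfin⟩
    obtain ⟨A', h1, h2, h3, h4⟩ := exists_le_opNorm_commutator_le Φ hε0 hε hP hfin hP1 hPT hr hL
      hA0 hA1 hAfin (hδ M) M
    exact ⟨⟨A', h1, h2, h3⟩, h4⟩
  choose next hmono happrox hnorm using hstep
  let A₀ : G := ⟨P 0, (hP 0).nonneg, (hP 0).le_one, hfin 0⟩
  let A : ℕ → G := fun m => Nat.rec A₀ next m
  have hAmono : Monotone fun m => (A m).1 := monotone_nat_of_le_succ fun m => hmono m (A m)
  -- The shift skips the initial `A₀`, for which no commutator bound is available.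
  have hAlim : ∀ v, Tendsto (fun m => (A (m + 1)).1 v) atTop (𝓝 v) := by
    intro v
    choose q hq hqP using fun m => happrox m (A m)
    have h1 : Tendsto (fun m => P (q m) v) atTop (𝓝 v) :=
      (hP1 v).comp (tendsto_atTop_mono hq tendsto_id)
    have h2 : Tendsto (fun m => (A (m + 1)).1 - P (q m)) atTop (𝓝 0) :=
      squeeze_zero_norm hqP tendsto_one_div_add_atTop_nhds_zero_nat
    have h3 := ((ContinuousLinearMap.apply ℂ H v).continuous.tendsto 0).comp h2
    have h4 := h3.add h1
    simp only [map_zero, zero_add] at h4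
    refine h4.congr fun m => ?_
    simp
  -- The modulus requires convergent commutator norms; compactness of `[0, ∞]` supplies a
  -- subsequence.
  obtain ⟨C, φ, hφ, hC⟩ := CompactSpace.tendsto_subseq
    fun m => ⨆ j, Φ.opNorm ((A (m + 1)).1 * T j - T j * (A (m + 1)).1)
  have hφ' := hφ.tendsto_atTop
  have hunit : IsFiniteRankApproxUnit fun m => (A (φ m + 1)).1 :=
    ⟨fun m => (A (φ m + 1)).2.2.2, fun m => (A (φ m + 1)).2.1, fun m => (A (φ m + 1)).2.2.1,
      fun a b hab => hAmono (Nat.succ_le_succ (hφ.monotone hab)), fun v => (hAlim v).comp hφ'⟩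
  have hle : quasicentralModulus Φ T ≤ C := sInf_le ⟨_, hunit, hC⟩
  refine hle.trans ?_
  have hlim : Tendsto (fun m => 2 * U + ENNReal.ofReal (1 / ((φ m : ℝ) + 1))) atTop
      (𝓝 (2 * U)) := by
    have h1 := (ENNReal.tendsto_ofReal
      ((tendsto_one_div_add_atTop_nhds_zero_nat (𝕜 := ℝ)).comp hφ')).const_add (2 * U)
    rwa [ENNReal.ofReal_zero, add_zero] at h1
  exact le_of_tendsto_of_tendsto' hC hlim fun m => iSup_le fun j => hnorm (φ m) (A (φ m)) j

end Main

theorem mainTheorem2 {H : Type*} [NormedAddCommGroup H] [InnerProductSpace ℂ H] [CompleteSpace H]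
    (Φ : NormingFunction) {n : ℕ} (T : Fin n → H →L[ℂ] H)
    (hT : ∀ j, IsSelfAdjoint (T j)) (hcomm : ∀ i j, Commute (T i) (T j))
    (ξ : H) (hξ : IsCyclicVector T ξ) :
    quasicentralModulus Φ T ≤ 2 * hausdorffContent Φ (jointSpectrum T) := by
  rcases eq_or_ne (hausdorffContent Φ (jointSpectrum T)) ⊤ with htop | hfin
  · rw [htop, ENNReal.mul_top two_ne_zero]
    exact le_top
  have hε : ∀ m : ℕ, (0 : ℝ) < 1 / ((m : ℝ) + 1) := fun m => Nat.one_div_pos_of_nat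
  choose N x r hr hanti hr0 hcov hΦ using fun m : ℕ =>
    exists_finite_antitone_cover Φ (isCompact_jointSpectrum hT hcomm) hfin (hε m)
  choose P hP hPξ hrank hL using fun m =>
    exists_projection_of_cover hT hcomm ξ (hr m) (hanti m) (hcov m)
  have hPT : ∀ i, Tendsto (fun m => P m * T i - T i * P m) atTop (𝓝 0) := by
    intro i
    refine squeeze_zero_norm (fun m => ?_) (tendsto_one_div_add_atTop_nhds_zero_nat (𝕜 := ℝ))
    -- For `k = 0` the approximant has rank `0`, so the commutator itself has norm at most `r m 0`.
    obtain ⟨L, hL0, hLr⟩ := hL m i 0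
    have h1 : (L : H →ₗ[ℂ] H) = 0 := by
      rw [mul_zero, Nat.cast_zero, nonpos_iff_eq_zero, LinearMap.rank, rank_zero_iff] at hL0
      ext v
      exact congrArg Subtype.val
        (Subsingleton.elim (⟨L v, v, rfl⟩ : LinearMap.range (L : H →ₗ[ℂ] H)) 0)
    have h2 : L = 0 := ContinuousLinearMap.coe_injective h1
    rw [h2, sub_zero] at hLr
    exact hLr.trans (hr0 m)
  exact quasicentralModulus_le_of_projections Φ (fun m => (hε m).le)
    tendsto_one_div_add_atTop_nhds_zero_nat hP
    (fun m => Module.rank_lt_aleph0_iff.mp ((hrank m).trans_lt Cardinal.natCast_lt_aleph0))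
    (hξ.tendsto_apply (fun m => (hP m).norm_le) hPξ hPT) hPT hΦ hL
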